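/- **Theorem (EBP is equivalent to Positivity).** Consider the following two decision problems. * *The Exponential-Bound Problem (EBP).* Input: a deterministic finite automaton $\mathcal A$ (with a possibly partial transition function, given by its transition table) over a finite alphabet $\Sigma=\{0,\dots,k-1\}$, with language $L=L(\mathcal A)\subseteq\Sigma^*$. Question: is $|L_n|\le 2^n$ for every $n\ge 0$, where $L_n$ is the set of words of length $n$ in $L$? * *The Positivity Problem.* Input: an integer linear recurrence sequence $\langle u_n\rangle_{n\ge 0}$, given by its order $d$, integers $a_1,\dots,a_d$ and integer initial values $u_0,\dots,u_{d-1}$, where $u_{n+d}=a_1u_{n+d-1}+a_2u_{n+d-2}+\dots+a_du_n$ for all $n\ge 0$ (for $d=0$ the sequence is identically zero). Question: is $u_n\ge 0$ for every $n\ge 0$? Then EBP and Positivity are many-one interreducible: there are a computable many-one reduction from EBP to Positivity and a computable many-one reduction from Positivity to EBP. Moreover, EBP is the total decomposition problem for equality relations with a binary intermediate alphabet: for every regular language $L$ over a finite alphabet $\Sigma$, one has $|L_n|\le 2^n$ for every $n\ge 0$ if and only if there are relations $R_1\subseteq\Sigma^*\times\{0,1\}^*$ and $R_2\subseteq\{0,1\}^*\times\Sigma^*$,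 both relating only words of equal length, such that every $b$ with $(w,b)\in R_1$ for some $w$ satisfies $(b,v)\in R_2$ for some $v$, and such that the composition $R_1\circ R_2=\{(w,v)\mid \exists b:\ (w,b)\in R_1,\ (b,v)\in R_2\}$ equals $\{(w,w)\mid w\in L\}$. -/

import Mathlib

/-- A deterministic finite automaton `(Σ, Q, q, δ, F)` presented as concrete finite data.
The alphabet is `Σ = {0, …, letters - 1}`, the state set is `Q = {0, …, rows.length - 1}`, and
`start` is the initial state. Row `q` of the table holds a Boolean that tells whether the state `q`
is accepting, and the list whose `a`-th entry is the unique `a`-successor of `q`,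
or `none` if `q` has no `a`-successor. -/
structure FinDFA where
  letters : ℕ
  start : ℕ
  rows : List (Bool × List (Option ℕ))
  start_lt : start < rows.length
  row_length : ∀ r ∈ rows, r.2.length = letters
  target_lt : ∀ r ∈ rows, ∀ o ∈ r.2, ∀ t ∈ o, t < rows.length

namespace FinDFA

/-- The (partial) transition function `δ`. -/
def next (A : FinDFA) (q : Fin A.rows.length) (a : Fin A.letters) :
    Option (Fin A.rows.length) :=
  ((A.rows.get q).2[(a : ℕ)]'(by
    rw [A.row_length _ (List.get_mem _ q)]; exact a.isLt)).pmap Fin.mk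
    (A.target_lt _ (List.get_mem _ q) _ (List.getElem_mem _))

/-- The automaton as a Mathlib `DFA`; the extra state `none` is a rejecting sink which takes the
undefined transitions. -/
def toDFA (A : FinDFA) : DFA (Fin A.letters) (Option (Fin A.rows.length)) where
  step s a := s.bind fun q => A.next q a
  start := some ⟨A.start, A.start_lt⟩
  accept := {s | ∃ q : Fin A.rows.length, s = some q ∧ (A.rows.get q).1 = true}

/-- The regular language `L(A)`. -/
def language (A : FinDFA) : Language (Fin A.letters) := A.toDFA.accepts

/-- Being a well-formed transition table, for raw data `(letters, start, rows)`. -/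
def Valid (c : ℕ × ℕ × List (Bool × List (Option ℕ))) : Prop :=
  c.2.1 < c.2.2.length ∧ (∀ r ∈ c.2.2, r.2.length = c.1) ∧
    ∀ r ∈ c.2.2, ∀ o ∈ r.2, ∀ t ∈ o, t < c.2.2.length

instance : DecidablePred Valid := fun c => by unfold Valid; infer_instance

/-- A `FinDFA` is the same thing as a well-formed transition table. -/
def equivValid : FinDFA ≃ {c // Valid c} where
  toFun A := ⟨(A.letters, A.start, A.rows), A.start_lt, A.row_length, A.target_lt⟩
  invFun c := ⟨c.1.1, c.1.2.1, c.1.2.2, c.2.1, c.2.2.1, c.2.2.2⟩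
  left_inv _ := rfl
  right_inv _ := rfl

theorem primrecPred_valid : PrimrecPred Valid := by
  have hE : PrimrecRel fun (o : Option ℕ) (m : ℕ) => o = none ∨ o.getD 0 < m :=
    PrimrecPred.or (Primrec.eq.comp .fst (.const none))
      (Primrec.nat_lt.comp (Primrec.option_getD.comp .fst (.const 0)) .snd)
  have hR : PrimrecRel fun (r : Bool × List (Option ℕ)) (m : ℕ) =>
      ∀ o ∈ r.2, o = none ∨ o.getD 0 < m :=
    hE.forall_mem_list.comp (Primrec.snd.comp .fst) .snd
  have hL : PrimrecRel fun (r : Bool × List (Option ℕ)) (k : ℕ) => r.2.length = k :=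
    Primrec.eq.comp (Primrec.list_length.comp (Primrec.snd.comp .fst)) .snd
  have rows : Primrec fun c : ℕ × ℕ × List (Bool × List (Option ℕ)) => c.2.2 :=
    Primrec.snd.comp .snd
  have len := Primrec.list_length.comp rows
  refine PrimrecPred.of_eq (((Primrec.nat_lt.comp (Primrec.fst.comp .snd) len).and
    ((hL.forall_mem_list.comp rows .fst).and (hR.forall_mem_list.comp rows len)))) fun c => ?_
  unfold Valid
  refine and_congr_right fun _ => and_congr_right fun _ => forall₂_congr fun r _ =>
    forall₂_congr fun o _ => ?_
  cases o <;> simp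

/-- Automata are coded by natural numbers through the standard code of their tables. -/
instance : Primcodable FinDFA :=
  letI := Primcodable.subtype primrecPred_valid
  Primcodable.ofEquiv {c // Valid c} equivValid

end FinDFA

/-- `|L_n| ≤ 2 ^ n` for every `n`, where `L_n` is the set of words of length `n` in `L`. -/
def ExponentiallyBounded {σ : Type*} (L : Language σ) : Prop :=
  ∀ n : ℕ, {w : List σ | w ∈ L ∧ w.length = n}.ncard ≤ 2 ^ n

/-- The Exponential-Bound Problem, for regular languages given by deterministic automata. -/
def EBP (A : FinDFA) : Prop := ExponentiallyBounded A.language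

/-- An integer linear recurrence sequence of order `d` presented as concrete finite data:
the list `[(c₀, u₀), …, (c_{d-1}, u_{d-1})]` of the coefficients of the recurrence
`u (n + d) = c₀ * u n + c₁ * u (n + 1) + ⋯ + c_{d-1} * u (n + d - 1)`
together with the initial values. -/
abbrev LRS := List (ℤ × ℤ)

namespace LRS

/-- The recurrence relation. -/
def recurrence (l : LRS) : LinearRecurrence ℤ where
  order := l.length
  coeffs i := (l.get i).1

/-- The sequence itself: the solution of the recurrence with the given initial values. -/
def seq (l : LRS) : ℕ → ℤ := l.recurrence.mkSol fun i => (l.get i).2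

end LRS

/-- The Positivity Problem. -/
def Positivity (l : LRS) : Prop := ∀ n : ℕ, 0 ≤ l.seq n

/-- The TD condition: `Img R₁ ⊆ Dom R₂` and `R₁ ∘ R₂ = R`. -/
def TDCondition {I B O : Type*} (R : Set (I × O)) (R₁ : Set (I × B)) (R₂ : Set (B × O)) : Prop :=
  (∀ i b, (i, b) ∈ R₁ → ∃ o, (b, o) ∈ R₂) ∧
    ∀ i o, (i, o) ∈ R ↔ ∃ b, (i, b) ∈ R₁ ∧ (b, o) ∈ R₂

/-- The equality relation over `L`. -/
def equalityRel {σ : Type*} (L : Language σ) : Set (List σ × List σ) :=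
  {p | p.1 ∈ L ∧ p.2 = p.1}

/-- A relation between words that relates only words of the same length. -/
def LengthPreserving {σ τ : Type*} (R : Set (List σ × List τ)) : Prop :=
  ∀ p ∈ R, p.1.length = p.2.length

/-- Total decomposability of the equality relation over `L` through the binary alphabet, by
length-preserving relations. -/
def EqualityTD {σ : Type*} (L : Language σ) : Prop :=
  ∃ (R₁ : Set (List σ × List Bool)) (R₂ : Set (List Bool × List σ)),
    LengthPreserving R₁ ∧ LengthPreserving R₂ ∧ TDCondition (equalityRel L) R₁ R₂

/-! ### Total decomposition of equality relations -/

/-! Equality relations: a decomposition picks for each `w ∈ L` a binary word of the same length, and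
the choice is injective because `R₁ ∘ R₂` relates `w` only to itself. Conversely, injections of each
level `L_n` into the binary words of length `n` serve as `R₁`, and their inverses as `R₂`.

EBP to Positivity: the vector of the counts from all states, extended by `2 ^ n`, evolves under one
integer linear map. By Cayley–Hamilton some vector of this orbit is an integer combination of the
earlier ones, and applying powers of the map turns this single identity into a recurrence for `2 ^ n
- |L_n|` (`exists_hasRelation`, `seq_toLRS`). Checking such an identity is primitive recursive, so
the reduction finds one by unbounded search instead of computing a characteristic polynomial.

Positivity to EBP: let `s` be `scale` and let `w` be the given sequence `u` spread out so that `u n`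
stands at place `s * n + (s - 1)`, with zeros elsewhere. The signs of `u` and `w` agree, and the
recurrence of `w` has order `s * d`. For each place `k` below this order two states count `2 ^ (n +
k + 1) ∓ w (n + k)` words of length `n + 1` (`count_succ_eq`). A negative coefficient leads to the
state of opposite sign, so all edge multiplicities are natural numbers, and a state counting `2 ^ (n
+ 1)` makes up the missing powers of two. For this the coefficients and initial values must be small
compared with powers of two, which the spreading ensures (`weight_le`, `signPart_stretchInit_le`).
From the initial state, `|L_{n+1}| = 2 ^ (n + 1) - w n`. -/

theorem ncard_listBool_length (n : ℕ) : {b : List Bool | b.length = n}.ncard = 2 ^ n := by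
  have h : Nat.card (List.Vector Bool n) = 2 ^ n := by simp [Nat.card_eq_fintype_card]
  exact h

theorem EqualityTD.exponentiallyBounded {σ : Type*} {L : Language σ} (h : EqualityTD L) :
    ExponentiallyBounded L := by
  obtain ⟨R₁, R₂, h₁, h₂, -, h⟩ := h
  have key : ∀ w ∈ L, ∃ b, (w, b) ∈ R₁ ∧ (b, w) ∈ R₂ := fun w hw => (h w w).1 ⟨hw, rfl⟩
  choose! f hf using key
  intro n
  rw [← ncard_listBool_length n]
  refine Set.ncard_le_ncard_of_injOn f ?_ ?_ (List.finite_length_eq Bool n)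
  · rintro w ⟨hw, rfl⟩
    exact (h₁ _ (hf w hw).1).symm
  · rintro w ⟨hw, -⟩ v ⟨hv, -⟩ e
    exact ((h w v).2 ⟨f w, (hf w hw).1, e ▸ (hf v hv).2⟩).2.symm

theorem ExponentiallyBounded.equalityTD {σ : Type*} [Finite σ] {L : Language σ}
    (h : ExponentiallyBounded L) : EqualityTD L := by
  have key : ∀ n, ∃ f : List σ → List Bool, Set.MapsTo f {w | w ∈ L ∧ w.length = n}
      {b | b.length = n} ∧ Set.InjOn f {w | w ∈ L ∧ w.length = n} := by
    intro n
    -- An infinite level would have `ncard` zero; finiteness of the alphabet makes the hypothesis a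
    -- genuine cardinality bound.
    have hfin : {w : List σ | w ∈ L ∧ w.length = n}.Finite :=
      (List.finite_length_eq σ n).subset fun w hw => hw.2
    refine hfin.exists_injOn_of_encard_le (t := {b : List Bool | b.length = n}) ?_ |>.imp
      fun f hf => ⟨hf.1, hf.2⟩
    rw [← hfin.cast_ncard_eq, ← (List.finite_length_eq Bool n).cast_ncard_eq,
      ncard_listBool_length]
    exact_mod_cast h n
  choose f hf hinj using key
  refine ⟨{p | p.1 ∈ L ∧ p.2 = f p.1.length p.1}, {p | p.2 ∈ L ∧ p.1 = f p.2.length p.2},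
    ?_, ?_, ?_, ?_⟩
  · rintro ⟨w, b⟩ ⟨hw, hb⟩
    dsimp only at hw hb
    subst hb
    exact (hf w.length ⟨hw, rfl⟩).symm
  · rintro ⟨b, w⟩ ⟨hw, hb⟩
    dsimp only at hw hb
    subst hb
    exact hf w.length ⟨hw, rfl⟩
  · rintro w b ⟨hw, hb⟩
    exact ⟨w, hw, hb⟩
  · intro w v
    constructor
    · rintro ⟨hw, e⟩
      obtain rfl : v = w := e
      exact ⟨f v.length v, ⟨hw, rfl⟩, hw, rfl⟩
    · rintro ⟨b, ⟨hw, hb⟩, hv, e⟩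
      dsimp only at hw hb hv e
      subst hb
      have hl : w.length = v.length := by
        have h1 : (f w.length w).length = w.length := hf _ ⟨hw, rfl⟩
        have h2 : (f v.length v).length = v.length := hf _ ⟨hv, rfl⟩
        rw [← h1, e, h2]
      exact ⟨hw, (hinj v.length ⟨hw, hl⟩ ⟨hv, rfl⟩ (hl ▸ e)).symm⟩

/-! ### Counting accepted words -/

/-- The number of words of length `n` which a transition table accepts from the state `q`. -/
def tableCount (rows : List (Bool × List (Option ℕ))) : ℕ → ℕ → ℕ
  | 0, q => rows[q]?.elim 0 fun r => r.1.toNat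
  | n + 1, q => rows[q]?.elim 0 fun r => (r.2.map fun o => o.elim 0 (tableCount rows n)).sum

namespace FinDFA

variable (A : FinDFA)

/-- The words of length `n` accepted from the state `s`. -/
def acceptedFrom (n : ℕ) (s : Option (Fin A.rows.length)) : Set (List (Fin A.letters)) :=
  {w | A.toDFA.evalFrom s w ∈ A.toDFA.accept ∧ w.length = n}

theorem none_notMem_accept : none ∉ A.toDFA.accept := by
  rintro ⟨q, h, -⟩
  cases h

theorem acceptedFrom_none (n : ℕ) : A.acceptedFrom n none = ∅ := by
  ext w
  have : ∀ w, A.toDFA.evalFrom none w = none := by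
    intro w
    induction w with
    | nil => rfl
    | cons a w ih => exact ih
  simp [acceptedFrom, this, none_notMem_accept]

theorem finite_acceptedFrom (n : ℕ) (s : Option (Fin A.rows.length)) :
    (A.acceptedFrom n s).Finite :=
  (List.finite_length_eq _ n).subset fun _ hw => hw.2

theorem ncard_acceptedFrom_zero (q : Fin A.rows.length) :
    (A.acceptedFrom 0 (some q)).ncard = (A.rows.get q).1.toNat := by
  have : A.acceptedFrom 0 (some q) = {w | w = [] ∧ (A.rows.get q).1 = true} := by
    ext w
    simp only [acceptedFrom, List.length_eq_zero_iff, Set.mem_ofPred_eq]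
    rw [and_comm]
    refine and_congr_right ?_
    rintro rfl
    constructor
    · rintro ⟨q', h, h'⟩
      cases h
      exact h'
    · exact fun h => ⟨q, rfl, h⟩
  rw [this]
  cases (A.rows.get q).1 <;> simp

theorem ncard_acceptedFrom_succ (n : ℕ) (s : Option (Fin A.rows.length)) :
    (A.acceptedFrom (n + 1) s).ncard =
      ∑ a, (A.acceptedFrom n (A.toDFA.step s a)).ncard := by
  have e : A.acceptedFrom (n + 1) s ≃ Σ a, A.acceptedFrom n (A.toDFA.step s a) :=
    { toFun := fun w => match w with
        | ⟨[], h⟩ => absurd h.2 (by simp)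
        | ⟨a :: w, h⟩ => ⟨a, w, h.1, by simpa using h.2⟩
      invFun := fun p => ⟨p.1 :: p.2.1, p.2.2.1, by simpa using p.2.2.2⟩
      left_inv := by
        rintro ⟨_ | ⟨a, w⟩, h⟩
        · exact absurd h.2 (by simp)
        · rfl
      right_inv := fun _ => rfl }
  have : ∀ a, Finite (A.acceptedFrom n (A.toDFA.step s a)) :=
    fun a => A.finite_acceptedFrom n _
  simp only [← Nat.card_coe_set_eq]
  rw [Nat.card_congr e, Nat.card_sigma]

theorem ncard_acceptedFrom (n : ℕ) (q : Fin A.rows.length) :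
    (A.acceptedFrom n (some q)).ncard = tableCount A.rows n q := by
  induction n generalizing q with
  | zero => simp [ncard_acceptedFrom_zero, tableCount]
  | succ n ih =>
    have hq : A.rows[(q : ℕ)]? = some (A.rows.get q) := by simp
    have hlen : (A.rows.get q).2.length = A.letters := A.row_length _ (List.get_mem _ q)
    rw [ncard_acceptedFrom_succ, tableCount, hq, Option.elim_some, ← Fin.sum_univ_getElem]
    refine Fintype.sum_equiv (finCongr (by rw [List.length_map, hlen])) _ _ fun a => ?_
    simp only [List.getElem_map, finCongr_apply, Fin.val_cast]
    have hn : A.toDFA.step (some q) a = A.next q a := rfl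
    rw [hn, next]
    set o := (A.rows.get q).2[(a : ℕ)]'(by rw [hlen]; exact a.isLt) with ho
    have hbound : ∀ t ∈ o, t < A.rows.length :=
      A.target_lt _ (List.get_mem _ q) _ (List.getElem_mem _)
    change (A.acceptedFrom n (o.pmap Fin.mk hbound)).ncard = o.elim 0 _
    clear_value o
    cases o with
    | none => simp [acceptedFrom_none]
    | some t => simpa using ih ⟨t, hbound t rfl⟩

theorem ebp_iff : EBP A ↔ ∀ n, tableCount A.rows n A.start ≤ 2 ^ n :=
  forall_congr' fun n => by
    rw [← A.ncard_acceptedFrom n ⟨A.start, A.start_lt⟩]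
    rfl

end FinDFA

/-! ### Primitive recursive functions -/

theorem Primrec.list_sum : Primrec (List.sum : List ℕ → ℕ) :=
  Primrec.list_foldr (f := id) (h := fun _ p => p.1 + p.2) .id (.const 0)
    (Primrec.nat_add.comp (Primrec.fst.comp .snd) (Primrec.snd.comp .snd)).to₂

theorem Primrec.nat_pow : Primrec₂ ((· ^ ·) : ℕ → ℕ → ℕ) :=
  Primrec₂.unpaired'.1 Nat.Primrec.pow

theorem Primrec.list_replicate {α : Type*} [Primcodable α] :
    Primrec₂ (List.replicate : ℕ → α → List α) :=
  (Primrec.list_map (f := fun p : ℕ × α => List.range p.1) (g := fun p _ => p.2)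
    (Primrec.list_range.comp .fst) (Primrec.snd.comp .fst).to₂).to₂.of_eq fun n a => by simp

theorem Primrec.option_elim {α β σ : Type*} [Primcodable α] [Primcodable β] [Primcodable σ]
    {o : α → Option β} {f : α → σ} {g : α → β → σ} (ho : Primrec o) (hf : Primrec f)
    (hg : Primrec₂ g) : Primrec fun a => (o a).elim (f a) (g a) :=
  (Primrec.option_casesOn ho hf hg).of_eq fun a => by cases o a <;> rfl

theorem Primrec.int_sub_natCast : Primrec₂ fun m n : ℕ => (m : ℤ) - n := by
  -- Computed on codes: `n` has code `2 * n`, and `-(k + 1)` has code `2 * k + 1`.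
  have h : Primrec₂ fun m n : ℕ => if n ≤ m then 2 * (m - n) else 2 * (n - m - 1) + 1 := by
    refine Primrec.ite (Primrec.nat_le.comp .snd .fst)
      (Primrec.nat_mul.comp (.const 2) (Primrec.nat_sub.comp .fst .snd)) ?_
    exact Primrec.succ.comp (Primrec.nat_mul.comp (.const 2)
      (Primrec.nat_sub.comp (Primrec.nat_sub.comp .snd .fst) (.const 1)))
  refine Primrec.encode_iff.1 (Primrec.of_eq (h : Primrec _) fun p => ?_)
  obtain ⟨m, n⟩ := p
  dsimp only
  split_ifs with hmn
  · rw [← Nat.cast_sub hmn]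
    rfl
  · obtain ⟨k, rfl⟩ := Nat.exists_eq_add_of_lt (not_le.1 hmn)
    have h1 : (m : ℤ) - (m + k + 1 : ℕ) = Int.negSucc k := by
      rw [Int.negSucc_eq]; push_cast; ring
    have h2 : m + k + 1 - m - 1 = k := by omega
    rw [h1, h2]
    rfl

theorem Primrec.int_toNat : Primrec Int.toNat := by
  have h : Primrec fun z : ℤ => if Encodable.encode z % 2 = 0 then Encodable.encode z / 2 else 0 :=
    Primrec.ite (Primrec.eq.comp (Primrec.nat_mod.comp .encode (.const 2)) (.const 0))
      (Primrec.nat_div.comp .encode (.const 2)) (.const 0)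
  refine h.of_eq fun z => ?_
  cases z with
  | ofNat n =>
    rw [show Encodable.encode (Int.ofNat n) = 2 * n from rfl, if_pos (by omega)]
    simp
  | negSucc n =>
    rw [show Encodable.encode (Int.negSucc n) = 2 * n + 1 from rfl, if_neg (by omega)]
    rfl

theorem Primrec.int_toNat_neg : Primrec fun z : ℤ => (-z).toNat := by
  have h : Primrec fun z : ℤ =>
      if Encodable.encode z % 2 = 0 then 0 else Encodable.encode z / 2 + 1 :=
    Primrec.ite (Primrec.eq.comp (Primrec.nat_mod.comp .encode (.const 2)) (.const 0))
      (.const 0) (Primrec.succ.comp (Primrec.nat_div.comp .encode (.const 2)))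
  refine h.of_eq fun z => ?_
  cases z with
  | ofNat n =>
    rw [show Encodable.encode (Int.ofNat n) = 2 * n from rfl, if_pos (by omega)]
    simp
  | negSucc n =>
    rw [show Encodable.encode (Int.negSucc n) = 2 * n + 1 from rfl, if_neg (by omega),
      Int.neg_negSucc]
    omega

/-- Unbounded search: a primitive recursive relation which is total has a computable choice
function. -/
theorem PrimrecRel.exists_computable_choice {α β : Type*} [Primcodable α] [Primcodable β]
    {R : α → β → Prop} (hR : PrimrecRel R) (h : ∀ a, ∃ b, R a b) :
    ∃ f : α → β, Computable f ∧ ∀ a, R a (f a) := by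
  classical
  let g : α → ℕ → Option β := fun a n =>
    (Encodable.decode (α := β) n).bind fun b => if R a b then some b else none
  have hg : Primrec₂ g := by
    refine Primrec.option_bind (Primrec.decode.comp .snd) ?_
    exact Primrec.ite (hR.comp (Primrec.fst.comp .fst) .snd) (Primrec.option_some.comp .snd)
      (.const none)
  have hmem : ∀ a n b, b ∈ g a n → R a b := by
    intro a n b hb
    obtain ⟨b', -, hb'⟩ := Option.bind_eq_some_iff.1 hb
    split_ifs at hb' with hR'
    cases hb'
    exact hR'
  have hdom : ∀ a, (Nat.rfindOpt (g a)).Dom := by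
    intro a
    obtain ⟨b, hb⟩ := h a
    exact Nat.rfindOpt_dom.2 ⟨Encodable.encode b, b, by simp [g, hb]⟩
  refine ⟨fun a => (Nat.rfindOpt (g a)).get (hdom a), ?_, fun a => ?_⟩
  · exact (Partrec.rfindOpt hg.to_comp).of_eq fun a => (Part.some_get (hdom a)).symm
  · obtain ⟨n, hn⟩ := Nat.rfindOpt_spec (Part.get_mem (hdom a))
    exact hmem _ _ _ hn

/-! ### Computability of the counts -/

theorem Primrec.finDFA_toRaw : Primrec fun A : FinDFA => (A.letters, A.start, A.rows) :=
  let := Primcodable.subtype FinDFA.primrecPred_valid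
  (Primrec.subtype_val (hp := FinDFA.primrecPred_valid)).comp
    (Primrec.of_equiv (e := FinDFA.equivValid))

theorem Primrec.finDFA_start : Primrec FinDFA.start :=
  Primrec.fst.comp (Primrec.snd.comp Primrec.finDFA_toRaw)

theorem Primrec.finDFA_rows : Primrec FinDFA.rows :=
  Primrec.snd.comp (Primrec.snd.comp Primrec.finDFA_toRaw)

theorem Primrec.tableCount : Primrec fun p : List (Bool × List (Option ℕ)) × ℕ × ℕ =>
    _root_.tableCount p.1 p.2.1 p.2.2 := by
  let T := List (Bool × List (Option ℕ))
  -- The recursion on the length changes the state, so the counts from all states are computed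
  -- together as a list. The default `0` agrees with `tableCount` outside the table.
  let c : T → ℕ → List ℕ := fun rows n => Nat.rec (rows.map fun r => r.1.toNat)
    (fun _ v => rows.map fun r => (r.2.map fun o => o.elim 0 fun t => v.getD t 0).sum) n
  have hc : Primrec₂ c := by
    refine Primrec.nat_rec (g := fun (rows : T) (p : ℕ × List ℕ) =>
      rows.map fun r => (r.2.map fun o => o.elim 0 fun t => p.2.getD t 0).sum) ?_ ?_
    · exact Primrec.list_map .id ((Primrec.dom_finite Bool.toNat).comp (Primrec.fst.comp .snd)).to₂
    · refine Primrec.list_map .fst (Primrec.to₂ (Primrec.list_sum.comp (Primrec.list_map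
        (Primrec.snd.comp .snd) (Primrec.to₂ (Primrec.option_elim (f := fun _ => 0)
          (g := fun (x : ((T × ℕ × List ℕ) × Bool × List (Option ℕ)) × Option ℕ) t =>
            x.1.1.2.2.getD t 0) .snd (.const 0) ?_)))))
      exact (Primrec.list_getD 0).comp
        (Primrec.snd.comp (Primrec.snd.comp (Primrec.fst.comp (Primrec.fst.comp .fst)))) .snd
  refine ((Primrec.list_getD 0).comp (hc.comp .fst (Primrec.fst.comp .snd))
    (Primrec.snd.comp .snd)).of_eq fun p => ?_
  obtain ⟨rows, n, q⟩ := p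
  dsimp only
  induction n generalizing q with
  | zero =>
    have : c rows 0 = rows.map fun r => r.1.toNat := rfl
    rw [this, _root_.tableCount, List.getD_eq_getElem?_getD, List.getElem?_map]
    cases rows[q]? <;> rfl
  | succ n ih =>
    have : c rows (n + 1) =
      rows.map fun r => (r.2.map fun o => o.elim 0 fun t => (c rows n).getD t 0).sum := rfl
    rw [this, _root_.tableCount, List.getD_eq_getElem?_getD, List.getElem?_map]
    simp only [ih]
    cases rows[q]? <;> rfl

/-! ### Linear recurrence sequences -/

namespace LRS

theorem seq_add_length (l : LRS) (n : ℕ) :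
    l.seq (n + l.length) = ∑ i ∈ Finset.range l.length, (l.getD i (0, 0)).1 * l.seq (n + i) := by
  rw [Finset.sum_range]
  refine (l.recurrence.is_sol_mkSol _ n).trans (Finset.sum_congr rfl fun i _ => ?_)
  rw [List.getD_eq_getElem _ _ i.isLt]
  rfl

theorem seq_of_lt (l : LRS) {i : ℕ} (h : i < l.length) : l.seq i = (l.getD i (0, 0)).2 := by
  rw [List.getD_eq_getElem _ _ h]
  exact l.recurrence.mkSol_eq_init _ ⟨i, h⟩

theorem seq_eq_of_recurrence (l : LRS) (w : ℕ → ℤ)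
    (h : ∀ n, w (n + l.length) = ∑ i ∈ Finset.range l.length, (l.getD i (0, 0)).1 * w (n + i))
    (h₀ : ∀ i < l.length, w i = (l.getD i (0, 0)).2) (n : ℕ) : l.seq n = w n := by
  refine (l.recurrence.eq_mk_of_is_sol_of_eq_init (u := w) (fun n => ?_) (fun i => ?_) n).symm
  · refine (h n).trans ?_
    rw [Finset.sum_range]
    refine (Finset.sum_congr rfl fun i _ => ?_)
    rw [List.getD_eq_getElem _ _ i.isLt]
    rfl
  · rw [h₀ i i.isLt, List.getD_eq_getElem _ _ i.isLt]
    rfl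

end LRS

/-! ### From automata to linear recurrences -/

/-- `m` lists the positive and negative parts of the coefficients of a linear relation expressing
`v m.length` through the preceding terms. -/
def InitialRelation (m : List (ℕ × ℕ)) (v : ℕ → ℕ) : Prop :=
  v m.length + ((List.range m.length).map fun i => (m.getD i (0, 0)).2 * v i).sum =
    ((List.range m.length).map fun i => (m.getD i (0, 0)).1 * v i).sum

theorem List.sum_map_range_eq_sum {M : Type*} [AddCommMonoid M] (f : ℕ → M) (n : ℕ) :
    ((List.range n).map f).sum = ∑ i ∈ Finset.range n, f i := rfl

/-- Two natural parts per coefficient keep the relation checkable by arithmetic on `ℕ`; over `ℤ`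
they merge into one coefficient. -/
theorem initialRelation_iff (m : List (ℕ × ℕ)) (v : ℕ → ℕ) : InitialRelation m v ↔
    (v m.length : ℤ) = ∑ i ∈ Finset.range m.length,
      (((m.getD i (0, 0)).1 : ℤ) - (m.getD i (0, 0)).2) * v i := by
  rw [InitialRelation, ← Int.natCast_inj]
  simp only [sub_mul, Finset.sum_sub_distrib, List.sum_map_range_eq_sum]
  push_cast
  exact eq_sub_iff_add_eq.symm

theorem PrimrecPred.initialRelation {α : Type*} [Primcodable α] {m : α → List (ℕ × ℕ)}
    {v : α → ℕ → ℕ} (hm : Primrec m) (hv : Primrec₂ v) :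
    PrimrecPred fun a => InitialRelation (m a) (v a) := by
  have hs : ∀ {f : ℕ × ℕ → ℕ}, Primrec f →
      Primrec fun a => ((List.range (m a).length).map fun i =>
        f ((m a).getD i (0, 0)) * v a i).sum := by
    intro f hf
    refine Primrec.list_sum.comp (Primrec.list_map
      (Primrec.list_range.comp (Primrec.list_length.comp hm)) ?_)
    exact Primrec.nat_mul.comp (hf.comp ((Primrec.list_getD _).comp (hm.comp .fst) .snd)) hv
  exact Primrec.eq.comp (Primrec.nat_add.comp (hv.comp .id (Primrec.list_length.comp hm))
    (hs .snd)) (hs .fst)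

namespace FinDFA

/-- `m` is an initial relation of all counting sequences of `A`, and of the powers of two. -/
def HasRelation (A : FinDFA) (m : List (ℕ × ℕ)) : Prop :=
  (∀ q < A.rows.length, InitialRelation m fun n => tableCount A.rows n q) ∧
    InitialRelation m (2 ^ ·)

theorem primrecRel_hasRelation : PrimrecRel HasRelation := by
  refine PrimrecPred.and ?_ ?_
  · have h : PrimrecRel fun (q : ℕ) (p : FinDFA × List (ℕ × ℕ)) =>
        InitialRelation p.2 fun n => tableCount p.1.rows n q := by
      have hr : Primrec fun x : (ℕ × FinDFA × List (ℕ × ℕ)) × ℕ => x.1.2.1.rows :=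
        Primrec.finDFA_rows.comp (Primrec.fst.comp (Primrec.snd.comp .fst))
      have hn : Primrec fun x : (ℕ × FinDFA × List (ℕ × ℕ)) × ℕ => (x.2, x.1.1) :=
        Primrec.pair .snd (Primrec.fst.comp .fst)
      exact PrimrecPred.initialRelation (m := fun x : ℕ × FinDFA × List (ℕ × ℕ) => x.2.2)
        (v := fun x n => tableCount x.2.1.rows n x.1) (Primrec.snd.comp .snd)
        (Primrec.tableCount.comp (hr.pair hn)).to₂
    refine PrimrecPred.of_eq (h.forall_mem_list.comp (Primrec.list_range.comp
      (Primrec.list_length.comp (Primrec.finDFA_rows.comp .fst))) .id) fun p => ?_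
    simp
  · exact PrimrecPred.initialRelation .snd (Primrec.nat_pow.comp (.const 2) .snd)

/-- The linear map sending the vector of the counts of words of length `n`, extended by `2 ^ n`,
to the next one. -/
def countStep (A : FinDFA) :
    (Option (Fin A.rows.length) → ℤ) →ₗ[ℤ] (Option (Fin A.rows.length) → ℤ) where
  toFun v s := s.elim (2 * v none) fun q => ((A.rows.get q).2.map fun o =>
    o.elim 0 fun t => if h : t < A.rows.length then v (some ⟨t, h⟩) else 0).sum
  map_add' v w := by
    ext s
    cases s with
    | none => simp [mul_add]
    | some q =>
      simp only [Option.elim_some, Pi.add_apply, ← List.sum_map_add]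
      congr 2
      ext o
      cases o with
      | none => simp
      | some t => dsimp; split_ifs <;> simp
  map_smul' c v := by
    ext s
    cases s with
    | none => simp [mul_left_comm]
    | some q =>
      simp only [Option.elim_some, Pi.smul_apply, smul_eq_mul, RingHom.id_apply,
        ← List.sum_map_mul_left]
      congr 2
      ext o
      cases o with
      | none => simp
      | some t => dsimp; split_ifs <;> simp

/-- The vector of the counts of words of length `n`, extended by `2 ^ n`. -/
def countVec (A : FinDFA) (n : ℕ) : Option (Fin A.rows.length) → ℤ :=
  fun s => s.elim (2 ^ n) fun q => tableCount A.rows n q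

theorem countStep_countVec (A : FinDFA) (n : ℕ) :
    A.countStep (A.countVec n) = A.countVec (n + 1) := by
  ext s
  cases s with
  | none => simp [countStep, countVec, pow_succ']
  | some q =>
    have hq : A.rows[(q : ℕ)]? = some (A.rows.get q) := by simp
    change (List.map _ _).sum = ((tableCount A.rows (n + 1) q : ℕ) : ℤ)
    rw [tableCount, hq, Option.elim_some, Nat.cast_list_sum, List.map_map]
    congr 1
    refine List.map_congr_left fun o ho => ?_
    cases o with
    | none => simp
    | some t =>
      have ht : t < A.rows.length := A.target_lt _ (List.get_mem _ q) _ ho t rfl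
      simp [ht, countVec]

theorem countStep_pow_countVec (A : FinDFA) (k n : ℕ) :
    (A.countStep ^ k) (A.countVec n) = A.countVec (n + k) := by
  induction k with
  | zero => simp
  | succ k ih => rw [pow_succ', Module.End.mul_apply, ih, countStep_countVec, add_assoc]

/-- The same coefficients serve every state and the powers of two, so the finitely many conditions
form one vector identity, to which powers of `countStep` can be applied. -/
theorem hasRelation_iff (A : FinDFA) (m : List (ℕ × ℕ)) : A.HasRelation m ↔
    A.countVec m.length = ∑ i ∈ Finset.range m.length,
      (((m.getD i (0, 0)).1 : ℤ) - (m.getD i (0, 0)).2) • A.countVec i := by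
  rw [HasRelation]
  simp only [initialRelation_iff]
  rw [funext_iff, Option.forall, and_comm]
  refine and_congr ?_ ?_
  · simp [countVec]
  · simp [countVec, Fin.forall_iff]

/-- Cayley–Hamilton: the characteristic polynomial of `countStep` is monic with integer coefficients
and annihilates the orbit of `countVec 0`. -/
theorem exists_hasRelation (A : FinDFA) : ∃ m, A.HasRelation m := by
  set p := A.countStep.charpoly with hp
  refine ⟨(List.range p.natDegree).map fun i => ((-p.coeff i).toNat, (p.coeff i).toNat), ?_⟩
  rw [hasRelation_iff]
  have h := congrArg (fun f => f (A.countVec 0)) (LinearMap.aeval_self_charpoly A.countStep)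
  simp only [← hp, LinearMap.zero_apply] at h
  rw [Polynomial.aeval_eq_sum_range, Finset.sum_range_succ,
    (LinearMap.charpoly_monic A.countStep).coeff_natDegree] at h
  simp only [LinearMap.add_apply, LinearMap.sum_apply, LinearMap.smul_apply,
    countStep_pow_countVec, zero_add, one_smul] at h
  simp only [List.length_map, List.length_range]
  rw [eq_neg_of_add_eq_zero_right h, ← Finset.sum_neg_distrib]
  refine Finset.sum_congr rfl fun i hi => ?_
  rw [List.getD_eq_getElem _ _ (by simpa using hi)]
  simp only [List.getElem_map, List.getElem_range, ← neg_smul]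
  congr 1
  omega

/-- The linear recurrence of `2 ^ n - |L_n|` obtained from an initial relation. -/
def toLRS (A : FinDFA) (m : List (ℕ × ℕ)) : LRS :=
  (List.range m.length).map fun i => (((m.getD i (0, 0)).1 : ℤ) - (m.getD i (0, 0)).2,
    ((2 ^ i : ℕ) : ℤ) - (tableCount A.rows i A.start : ℕ))

theorem primrec_toLRS : Primrec₂ toLRS := by
  refine Primrec.list_map (Primrec.list_range.comp (Primrec.list_length.comp .snd)) ?_
  have hm : Primrec fun p : (FinDFA × List (ℕ × ℕ)) × ℕ => p.1.2.getD p.2 (0, 0) :=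
    (Primrec.list_getD _).comp (Primrec.snd.comp .fst) .snd
  have hA : Primrec fun p : (FinDFA × List (ℕ × ℕ)) × ℕ => p.1.1 := Primrec.fst.comp .fst
  refine Primrec.pair (Primrec.int_sub_natCast.comp (Primrec.fst.comp hm) (Primrec.snd.comp hm)) ?_
  exact Primrec.int_sub_natCast.comp (Primrec.nat_pow.comp (.const 2) .snd)
    (Primrec.tableCount.comp (Primrec.pair (Primrec.finDFA_rows.comp hA)
      (Primrec.pair .snd (Primrec.finDFA_start.comp hA))))

theorem seq_toLRS {A : FinDFA} {m : List (ℕ × ℕ)} (h : A.HasRelation m) (n : ℕ) :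
    (A.toLRS m).seq n = 2 ^ n - tableCount A.rows n A.start := by
  have hv : ∀ n, (2 : ℤ) ^ n - tableCount A.rows n A.start =
      A.countVec n none - A.countVec n (some ⟨A.start, A.start_lt⟩) := fun n => rfl
  have hlen : (A.toLRS m).length = m.length := by simp [toLRS]
  have hget : ∀ i < m.length, (A.toLRS m).getD i (0, 0) =
      (((m.getD i (0, 0)).1 : ℤ) - (m.getD i (0, 0)).2,
        ((2 ^ i : ℕ) : ℤ) - (tableCount A.rows i A.start : ℕ)) := by
    intro i hi
    rw [List.getD_eq_getElem _ _ (by rwa [hlen])]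
    simp [toLRS]
  refine (A.toLRS m).seq_eq_of_recurrence
    (fun n => 2 ^ n - tableCount A.rows n A.start) (fun n => ?_) (fun i hi => ?_) n
  · rw [hasRelation_iff] at h
    -- The linear map shifts the index, so the relation at time `0` holds at every time `n`.
    have h' := congrArg (A.countStep ^ n) h
    simp only [map_sum, map_smul, countStep_pow_countVec] at h'
    simp only [hv, hlen]
    rw [add_comm n, h']
    simp only [Finset.sum_apply, Pi.smul_apply, smul_eq_mul, ← Finset.sum_sub_distrib]
    refine Finset.sum_congr rfl fun i hi => ?_
    rw [hget i (Finset.mem_range.1 hi), mul_sub, add_comm n]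
  · rw [hget i (hlen ▸ hi)]
    push_cast
    rfl

end FinDFA

theorem ebp_manyOneReducible_positivity : EBP ≤₀ Positivity := by
  obtain ⟨f, hf, h⟩ :=
    FinDFA.primrecRel_hasRelation.exists_computable_choice FinDFA.exists_hasRelation
  refine ⟨fun A => A.toLRS (f A), FinDFA.primrec_toLRS.to_comp.comp .id hf, fun A => ?_⟩
  rw [FinDFA.ebp_iff, Positivity]
  refine forall_congr' fun n => ?_
  rw [FinDFA.seq_toLRS (h A), sub_nonneg]
  exact_mod_cast Iff.rfl

/-! ### Automata from unpadded transition tables -/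

namespace FinDFA

/-- The padded rows of the transition table whose `q`-th row lists the successors of `q`. -/
def padRows (T : List (Bool × List ℕ)) : List (Bool × List (Option ℕ)) :=
  T.map fun r => (r.1, (r.2.map fun t => if t < T.length then some t else none) ++
    List.replicate ((T.map fun r => r.2.length).sum - r.2.length) none)

/-- The automaton with initial state `0` whose `q`-th state has the successors listed in the `q`-th
row. -/
def ofTable (r : Bool × List ℕ) (R : List (Bool × List ℕ)) : FinDFA where
  -- Each edge of a row receives its own letter, so parallel edges stay deterministic. The sum of
  -- the row lengths is an alphabet size that suffices for every row.
  letters := ((r :: R).map fun r => r.2.length).sum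
  start := 0
  rows := padRows (r :: R)
  start_lt := by simp [padRows]
  row_length := by
    intro p hp
    obtain ⟨r', hr', rfl⟩ := List.mem_map.1 hp
    have := List.single_le_sum (fun _ _ => Nat.zero_le _) _
      (List.mem_map_of_mem (f := fun r : Bool × List ℕ => r.2.length) hr')
    rw [List.length_append, List.length_map, List.length_replicate]
    omega
  target_lt := by
    intro p hp o ho t ht
    obtain ⟨r', hr', rfl⟩ := List.mem_map.1 hp
    rw [padRows, List.length_map]
    rcases List.mem_append.1 ho with ho | ho
    · obtain ⟨t', -, rfl⟩ := List.mem_map.1 ho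
      split_ifs at ht with h
      · cases ht
        exact h
      · cases ht
    · rw [List.eq_of_mem_replicate ho] at ht
      cases ht

theorem primrec_padRows : Primrec padRows := by
  have h1 : Primrec₂ fun (T : List (Bool × List ℕ)) (r : Bool × List ℕ) =>
      r.2.map fun t => if t < T.length then some t else none :=
    Primrec.list_map (Primrec.snd.comp .snd) (Primrec.ite (Primrec.nat_lt.comp .snd
      (Primrec.list_length.comp (Primrec.fst.comp .fst)))
      (Primrec.option_some.comp .snd) (.const none)).to₂
  have h2 : Primrec fun T : List (Bool × List ℕ) => (T.map fun r => r.2.length).sum :=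
    Primrec.list_sum.comp (Primrec.list_map .id
      (Primrec.list_length.comp (Primrec.snd.comp .snd)).to₂)
  exact Primrec.list_map .id (Primrec.to₂ (Primrec.pair (Primrec.fst.comp .snd)
    (Primrec.list_append.comp h1 (Primrec.list_replicate.comp
      (Primrec.nat_sub.comp (h2.comp .fst) (Primrec.list_length.comp (Primrec.snd.comp .snd)))
      (.const none)))))

theorem primrec_ofTable : Primrec₂ ofTable := by
  have hT : Primrec fun p : (Bool × List ℕ) × List (Bool × List ℕ) => p.1 :: p.2 :=
    Primrec.list_cons.comp .fst .snd
  have h : Primrec fun p : (Bool × List ℕ) × List (Bool × List ℕ) =>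
      (((p.1 :: p.2).map fun r => r.2.length).sum, 0, padRows (p.1 :: p.2)) :=
    Primrec.pair (Primrec.list_sum.comp (Primrec.list_map hT
      (Primrec.list_length.comp (Primrec.snd.comp .snd)).to₂))
      (Primrec.pair (.const 0) (primrec_padRows.comp hT))
  let := Primcodable.subtype FinDFA.primrecPred_valid
  exact (Primrec.of_equiv_symm (e := FinDFA.equivValid)).comp
    (Primrec.subtype_mk (hp := FinDFA.primrecPred_valid)
      (h := fun p : (Bool × List ℕ) × List (Bool × List ℕ) => (equivValid (ofTable p.1 p.2)).2) h)

end FinDFA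

theorem tableCount_padRows_zero {T : List (Bool × List ℕ)} {q : ℕ} {r : Bool × List ℕ}
    (h : T[q]? = some r) : tableCount (FinDFA.padRows T) 0 q = r.1.toNat := by
  simp [tableCount, FinDFA.padRows, h]

theorem tableCount_padRows_succ {T : List (Bool × List ℕ)} {q : ℕ} {r : Bool × List ℕ}
    (h : T[q]? = some r) (n : ℕ) : tableCount (FinDFA.padRows T) (n + 1) q =
      (r.2.map (tableCount (FinDFA.padRows T) n)).sum := by
  have hq : (FinDFA.padRows T)[q]? = some (r.1, (r.2.map fun t =>
      if t < T.length then some t else none) ++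
        List.replicate ((T.map fun r => r.2.length).sum - r.2.length) none) := by
    rw [FinDFA.padRows, List.getElem?_map, h]
    rfl
  rw [tableCount, hq, Option.elim_some, List.map_append, List.sum_append, List.map_replicate,
    Option.elim_none, List.sum_replicate, smul_zero, add_zero, List.map_map]
  congr 1
  refine List.map_congr_left fun t _ => ?_
  dsimp only [Function.comp_apply]
  split_ifs with ht
  · rfl
  -- A target outside the table became `none` and contributes `0`, which is also the value of
  -- `tableCount` there.
  · have : (FinDFA.padRows T)[t]? = none :=
      List.getElem?_eq_none (by rw [FinDFA.padRows, List.length_map]; exact not_lt.1 ht)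
    cases n <;> simp [tableCount, this]

/-! ### From linear recurrences to automata -/

/-- The positive part of `z` for even `b`, the negative part for odd `b`. -/
def signPart (b : ℕ) (z : ℤ) : ℕ := if b % 2 = 0 then z.toNat else (-z).toNat

theorem Primrec.signPart : Primrec₂ signPart :=
  Primrec.ite (Primrec.eq.comp (Primrec.nat_mod.comp .fst (.const 2)) (.const 0))
    (Primrec.int_toNat.comp .snd) (Primrec.int_toNat_neg.comp .snd)

theorem signPart_sub_signPart_succ (b : ℕ) (z : ℤ) :
    (signPart b z : ℤ) - signPart (b + 1) z = (-1) ^ b * z := by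
  rcases Nat.even_or_odd b with hb | hb
  · have h1 := Nat.even_iff.1 hb
    have h2 : (b + 1) % 2 = 1 := by omega
    simp only [signPart, h1, h2, hb.neg_one_pow, if_true, one_ne_zero, if_false]
    omega
  · have h1 := Nat.odd_iff.1 hb
    have h2 : (b + 1) % 2 = 0 := by omega
    simp only [signPart, h1, h2, hb.neg_one_pow, if_true, one_ne_zero, if_false]
    omega

theorem signPart_add_signPart_succ (b : ℕ) (z : ℤ) :
    signPart b z + signPart (b + 1) z = z.natAbs := by
  rcases Nat.mod_two_eq_zero_or_one b with h1 | h1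
  · have h2 : (b + 1) % 2 = 1 := by omega
    simp only [signPart, h1, h2, if_true, one_ne_zero, if_false]
    omega
  · have h2 : (b + 1) % 2 = 0 := by omega
    simp only [signPart, h1, h2, if_true, one_ne_zero, if_false]
    omega

theorem signPart_le_natAbs (b : ℕ) (z : ℤ) : signPart b z ≤ z.natAbs := by
  rw [← signPart_add_signPart_succ b z]
  exact Nat.le_add_right _ _

theorem Primrec.int_natAbs : Primrec Int.natAbs :=
  (Primrec.nat_add.comp Primrec.int_toNat Primrec.int_toNat_neg).of_eq fun z => by omega

/-- The sequence with the term `u n` at the place `s * n + (s - 1)`, and `0` elsewhere. -/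
def stretch (s : ℕ) (u : ℕ → ℤ) (n : ℕ) : ℤ := if n % s = s - 1 then u (n / s) else 0

theorem stretch_nonneg_iff {s : ℕ} (hs : 0 < s) (u : ℕ → ℤ) :
    (∀ n, 0 ≤ stretch s u n) ↔ ∀ n, 0 ≤ u n := by
  constructor
  · intro h n
    have h1 : (s * n + (s - 1)) % s = s - 1 := by
      rw [Nat.mul_add_mod, Nat.mod_eq_of_lt (by omega)]
    have h2 : (s * n + (s - 1)) / s = n := by
      rw [Nat.mul_add_div hs, Nat.div_eq_of_lt (by omega), add_zero]
    have := h (s * n + (s - 1))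
    rwa [stretch, if_pos h1, h2] at this
  · intro h n
    rw [stretch]
    split_ifs
    exacts [h _, le_rfl]

theorem stretch_add_mul {s : ℕ} (hs : 0 < s) (u : ℕ → ℤ) (n i : ℕ) :
    stretch s u (n + s * i) = stretch s (fun k => u (k + i)) n := by
  rw [stretch, stretch, Nat.add_mul_mod_self_left, Nat.add_mul_div_left _ _ hs]

namespace LRS

variable (l : LRS)

/-- The `i`-th coefficient. -/
def coeff (i : ℕ) : ℤ := (l.getD i (0, 0)).1

/-- A number of letters which the automaton of a linear recurrence spends on one step. -/
def scale : ℕ :=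
  1 + ((List.range l.length).map fun i => (l.coeff i).natAbs + (l.getD i (0, 0)).2.natAbs).sum

/-- The order of the stretched recurrence. -/
def dim : ℕ := l.scale * l.length

/-- All shifts are multiples of `scale`, so either every term lies in the residue class that carries
the original sequence, or every term vanishes. -/
theorem stretch_add_dim (n : ℕ) : stretch l.scale l.seq (n + l.dim) =
    ∑ i ∈ Finset.range l.length, l.coeff i * stretch l.scale l.seq (n + l.scale * i) := by
  have hs : 0 < l.scale := by rw [scale]; omega
  simp only [dim, stretch_add_mul hs]
  simp only [stretch]
  split_ifs
  · exact l.seq_add_length _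
  · simp

/-- The total weight of the coefficients of the stretched recurrence. -/
def weight : ℕ :=
  ((List.range l.length).map fun i => (l.coeff i).natAbs * 2 ^ (l.scale * i)).sum

/-- The successors which realise the recurrence. -/
def recTargets (b : ℕ) : List ℕ :=
  ((List.range l.length).flatMap fun i =>
    List.replicate (signPart 0 (l.coeff i)) (2 * (l.scale * i) + b % 2) ++
      List.replicate (signPart 1 (l.coeff i)) (2 * (l.scale * i) + (b + 1) % 2)) ++
    List.replicate (2 ^ l.dim - l.weight) (2 * l.dim)

/-- The `k`-th initial value of the stretched recurrence. -/
def stretchInit (k : ℕ) : ℤ :=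
  if k % l.scale = l.scale - 1 then (l.getD (k / l.scale) (0, 0)).2 else 0

/-- The row of the state `q`: for `k < dim`, the states `2 * k` and `2 * k + 1` count
`2 ^ (n + k + 1) ∓ stretch scale seq (n + k)` words of length `n + 1`, the state `2 * dim` counts
`2 ^ (n + 1)` words of length `n + 1`, and the state `2 * dim + 1` accepts only the empty word. -/
def row (q : ℕ) : Bool × List ℕ :=
  if q / 2 < l.dim then
    (false, (if q / 2 + 1 < l.dim then [q + 2] else l.recTargets q) ++
      List.replicate (2 ^ (q / 2 + 1) + signPart (q + 1) (l.stretchInit (q / 2)) -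
        signPart q (l.stretchInit (q / 2))) (2 * l.dim + 1))
  else if q = 2 * l.dim then (false, [2 * l.dim, 2 * l.dim, 2 * l.dim + 1, 2 * l.dim + 1])
  else (true, [])

/-- The automaton of a linear recurrence. -/
def toFinDFA : FinDFA :=
  .ofTable (l.row 0) ((List.range (2 * l.dim + 1)).map fun q => l.row (q + 1))

/-! ### Computability of the automaton construction -/

theorem primrec_coeff : Primrec₂ coeff :=
  Primrec.fst.comp ((Primrec.list_getD (0, 0)).comp .fst .snd)

theorem primrec_scale : Primrec scale := by
  refine Primrec.nat_add.comp (.const 1) (Primrec.list_sum.comp (Primrec.list_map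
    (Primrec.list_range.comp Primrec.list_length) (Primrec.to₂ (Primrec.nat_add.comp
      (Primrec.int_natAbs.comp primrec_coeff)
      (Primrec.int_natAbs.comp (Primrec.snd.comp (Primrec.list_getD (0, 0))))))))

theorem primrec_dim : Primrec dim := Primrec.nat_mul.comp primrec_scale Primrec.list_length

theorem primrec_weight : Primrec weight := by
  refine Primrec.list_sum.comp (Primrec.list_map
    (Primrec.list_range.comp Primrec.list_length) (Primrec.to₂ (Primrec.nat_mul.comp
      (Primrec.int_natAbs.comp primrec_coeff)
      (Primrec.nat_pow.comp (.const 2)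
        (Primrec.nat_mul.comp (primrec_scale.comp .fst) .snd)))))

theorem primrec_recTargets : Primrec₂ recTargets := by
  have hc : Primrec fun x : (LRS × ℕ) × ℕ => x.1.1.coeff x.2 :=
    primrec_coeff.comp (Primrec.fst.comp .fst) .snd
  have hp : Primrec fun x : (LRS × ℕ) × ℕ => 2 * (x.1.1.scale * x.2) :=
    Primrec.nat_mul.comp (.const 2)
      (Primrec.nat_mul.comp (primrec_scale.comp (Primrec.fst.comp .fst)) .snd)
  have hb : Primrec fun x : (LRS × ℕ) × ℕ => x.1.2 := Primrec.snd.comp .fst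
  have hm : ∀ (c : ℕ) {f : (LRS × ℕ) × ℕ → ℕ}, Primrec f → Primrec fun x : (LRS × ℕ) × ℕ =>
      List.replicate (signPart c (x.1.1.coeff x.2)) (2 * (x.1.1.scale * x.2) + f x % 2) :=
    fun c _ hf => Primrec.list_replicate.comp (Primrec.signPart.comp (.const c) hc)
      (Primrec.nat_add.comp hp (Primrec.nat_mod.comp hf (.const 2)))
  have h1 : Primrec fun x : LRS × ℕ => (List.range x.1.length).flatMap fun i =>
      List.replicate (signPart 0 (x.1.coeff i)) (2 * (x.1.scale * i) + x.2 % 2) ++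
      List.replicate (signPart 1 (x.1.coeff i)) (2 * (x.1.scale * i) + (x.2 + 1) % 2) :=
    Primrec.list_flatMap (Primrec.list_range.comp (Primrec.list_length.comp .fst))
      (Primrec.to₂ (Primrec.list_append.comp (hm 0 hb) (hm 1 (Primrec.succ.comp hb))))
  exact Primrec.list_append.comp h1 (Primrec.list_replicate.comp
    (Primrec.nat_sub.comp (Primrec.nat_pow.comp (.const 2) (primrec_dim.comp .fst))
      (primrec_weight.comp .fst)) (Primrec.nat_mul.comp (.const 2) (primrec_dim.comp .fst)))

theorem primrec_stretchInit : Primrec₂ stretchInit := by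
  have hs : Primrec fun x : LRS × ℕ => x.1.scale := primrec_scale.comp .fst
  exact Primrec.ite (Primrec.eq.comp (Primrec.nat_mod.comp .snd hs)
    (Primrec.nat_sub.comp hs (.const 1)))
    (Primrec.snd.comp ((Primrec.list_getD (0, 0)).comp .fst (Primrec.nat_div.comp .snd hs)))
    (.const 0)

theorem primrec_row : Primrec₂ row := by
  have hk : Primrec fun x : LRS × ℕ => x.2 / 2 := Primrec.nat_div.comp .snd (.const 2)
  have hk1 : Primrec fun x : LRS × ℕ => x.2 / 2 + 1 := Primrec.succ.comp hk
  have hD : Primrec fun x : LRS × ℕ => x.1.dim := primrec_dim.comp .fst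
  have hZ : Primrec fun x : LRS × ℕ => 2 * x.1.dim := Primrec.nat_mul.comp (.const 2) hD
  have hF : Primrec fun x : LRS × ℕ => 2 * x.1.dim + 1 := Primrec.succ.comp hZ
  have hw : Primrec fun x : LRS × ℕ => x.1.stretchInit (x.2 / 2) :=
    primrec_stretchInit.comp .fst hk
  have hn : Primrec fun x : LRS × ℕ => ([] : List ℕ) := .const []
  have he : Primrec fun x : LRS × ℕ => List.replicate
      (2 ^ (x.2 / 2 + 1) + signPart (x.2 + 1) (x.1.stretchInit (x.2 / 2)) -
        signPart x.2 (x.1.stretchInit (x.2 / 2))) (2 * x.1.dim + 1) :=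
    Primrec.list_replicate.comp (Primrec.nat_sub.comp (Primrec.nat_add.comp
      (Primrec.nat_pow.comp (.const 2) hk1) (Primrec.signPart.comp (Primrec.succ.comp .snd) hw))
      (Primrec.signPart.comp .snd hw)) hF
  have ht : Primrec fun x : LRS × ℕ =>
      if x.2 / 2 + 1 < x.1.dim then [x.2 + 2] else x.1.recTargets x.2 :=
    Primrec.ite (Primrec.nat_lt.comp hk1 hD)
      (Primrec.list_cons.comp (Primrec.succ.comp (Primrec.succ.comp .snd)) hn)
      (primrec_recTargets.comp .fst .snd)
  have h2 : Primrec fun x : LRS × ℕ =>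
      [2 * x.1.dim, 2 * x.1.dim, 2 * x.1.dim + 1, 2 * x.1.dim + 1] :=
    Primrec.list_cons.comp hZ (Primrec.list_cons.comp hZ
      (Primrec.list_cons.comp hF (Primrec.list_cons.comp hF hn)))
  exact Primrec.ite (Primrec.nat_lt.comp hk hD)
    (Primrec.pair (.const false) (Primrec.list_append.comp ht he))
    (Primrec.ite (Primrec.eq.comp .snd hZ) (Primrec.pair (.const false) h2) (.const (true, [])))

theorem primrec_toFinDFA : Primrec toFinDFA :=
  FinDFA.primrec_ofTable.comp (primrec_row.comp .id (.const 0))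
    (Primrec.list_map (Primrec.list_range.comp (Primrec.succ.comp
      (Primrec.nat_mul.comp (.const 2) primrec_dim)))
      (primrec_row.comp .fst (Primrec.succ.comp .snd)).to₂)

end LRS

/-! ### Correctness of the automaton construction -/

namespace LRS

variable (l : LRS)

theorem scale_pos : 0 < l.scale := by rw [scale]; omega

theorem sum_natAbs_coeff_lt_scale :
    ∑ i ∈ Finset.range l.length, (l.coeff i).natAbs < l.scale := by
  rw [scale, List.sum_map_range_eq_sum, Finset.sum_add_distrib]
  omega

theorem natAbs_init_lt_scale (k : ℕ) : (l.getD k (0, 0)).2.natAbs < l.scale := by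
  by_cases hk : k < l.length
  · have := Finset.single_le_sum (f := fun i => (l.coeff i).natAbs + (l.getD i (0, 0)).2.natAbs)
      (fun _ _ => Nat.zero_le _) (Finset.mem_range.2 hk)
    rw [scale, List.sum_map_range_eq_sum]
    omega
  · rw [List.getD_eq_default _ _ (not_lt.1 hk)]
    exact l.scale_pos

/-- The factor `2 ^ (scale * i)` is at most `2 ^ (dim - scale)`, and the absolute values of the
coefficients sum to less than `scale < 2 ^ scale`. Hence the number of filler edges in `recTargets`
is not truncated. -/
theorem weight_le : l.weight ≤ 2 ^ l.dim := by
  rw [weight, List.sum_map_range_eq_sum]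
  have h : ∀ i ∈ Finset.range l.length, (l.coeff i).natAbs * 2 ^ (l.scale * i) ≤
      (l.coeff i).natAbs * 2 ^ (l.scale * (l.length - 1)) := by
    intro i hi
    have hi := Finset.mem_range.1 hi
    gcongr
    · norm_num
    · omega
  refine (Finset.sum_le_sum h).trans ?_
  rw [← Finset.sum_mul]
  rcases Nat.eq_zero_or_pos l.length with h0 | h0
  · simp [h0]
  · have : l.dim = l.scale + l.scale * (l.length - 1) := by
      obtain ⟨d, hd⟩ := Nat.exists_eq_add_of_le' h0
      rw [dim, hd]
      simp only [Nat.add_sub_cancel]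
      ring
    rw [this, pow_add]
    exact Nat.mul_le_mul_right _ (l.sum_natAbs_coeff_lt_scale.le.trans Nat.lt_two_pow_self.le)

/-- A nonzero value can occur only at the end of a block, where `scale ≤ k + 1`; this is why the
terms are placed last in their blocks. -/
theorem signPart_stretchInit_le (b k : ℕ) : signPart b (l.stretchInit k) ≤ 2 ^ (k + 1) := by
  refine (signPart_le_natAbs _ _).trans ?_
  rw [stretchInit]
  split_ifs with h
  · have h1 : l.scale ≤ k + 1 := by
      have := Nat.mod_le k l.scale
      omega
    exact (l.natAbs_init_lt_scale _).le.trans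
      (Nat.lt_two_pow_self.le.trans (Nat.pow_le_pow_right two_pos h1))
  · simp

theorem stretch_of_lt {k : ℕ} (h : k < l.dim) :
    stretch l.scale l.seq k = l.stretchInit k := by
  rw [stretch, stretchInit, l.seq_of_lt (Nat.div_lt_of_lt_mul h)]

/-- The number of words of length `n` accepted from the state `q`. -/
def count (n q : ℕ) : ℕ := tableCount l.toFinDFA.rows n q

theorem getElem?_table {q : ℕ} (hq : q < 2 * l.dim + 2) :
    (l.row 0 :: (List.range (2 * l.dim + 1)).map fun q => l.row (q + 1))[q]? =
      some (l.row q) := by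
  cases q with
  | zero => rfl
  | succ q => simp [List.getElem?_range (show q < 2 * l.dim + 1 by omega)]

theorem count_zero {q : ℕ} (hq : q < 2 * l.dim + 2) : l.count 0 q = (l.row q).1.toNat :=
  tableCount_padRows_zero (l.getElem?_table hq)

theorem count_succ {q : ℕ} (hq : q < 2 * l.dim + 2) (n : ℕ) :
    l.count (n + 1) q = ((l.row q).2.map (l.count n)).sum :=
  tableCount_padRows_succ (l.getElem?_table hq) n

theorem row_accept : l.row (2 * l.dim + 1) = (true, []) := by
  rw [row, if_neg (by omega), if_neg (by omega)]

theorem row_two_mul_dim : l.row (2 * l.dim) =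
    (false, [2 * l.dim, 2 * l.dim, 2 * l.dim + 1, 2 * l.dim + 1]) := by
  rw [row, if_neg (by omega), if_pos rfl]

theorem count_zero_accept : l.count 0 (2 * l.dim + 1) = 1 := by
  rw [l.count_zero (by omega), row_accept]
  rfl

theorem count_succ_accept (n : ℕ) : l.count (n + 1) (2 * l.dim + 1) = 0 := by
  rw [l.count_succ (by omega), row_accept]
  rfl

theorem count_zero_of_lt {q : ℕ} (hq : q < 2 * l.dim + 1) : l.count 0 q = 0 := by
  rw [l.count_zero (by omega), row]
  by_cases h1 : q / 2 < l.dim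
  · rw [if_pos h1]
    rfl
  · rw [if_neg h1, if_pos (by omega)]
    rfl

theorem count_succ_two_mul_dim (n : ℕ) : l.count (n + 1) (2 * l.dim) = 2 ^ (n + 1) := by
  induction n with
  | zero =>
    rw [l.count_succ (by omega), row_two_mul_dim]
    simp [count_zero_accept, l.count_zero_of_lt]
  | succ n ih =>
    rw [l.count_succ (by omega), row_two_mul_dim]
    simp only [List.map_cons, List.map_nil, List.sum_cons, List.sum_nil, ih, count_succ_accept]
    ring

theorem sum_map_recTargets (f : ℕ → ℕ) (b : ℕ) : ((l.recTargets b).map f).sum =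
    (∑ i ∈ Finset.range l.length,
      (signPart 0 (l.coeff i) * f (2 * (l.scale * i) + b % 2) +
        signPart 1 (l.coeff i) * f (2 * (l.scale * i) + (b + 1) % 2))) +
      (2 ^ l.dim - l.weight) * f (2 * l.dim) := by
  rw [recTargets, List.map_append, List.sum_append, List.map_flatMap,
    List.flatMap_def, List.sum_flatten, List.map_map, List.sum_map_range_eq_sum]
  simp

/-- The second summand counts the edges to the accepting state. As that state accepts only the empty
word, these edges set the number of words of length one and do not affect longer words. -/
theorem count_row {k b n : ℕ} (hk : k < l.dim) (hb : b < 2) :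
    l.count (n + 1) (2 * k + b) =
      (if k + 1 < l.dim then l.count n (2 * (k + 1) + b)
        else ((l.recTargets b).map (l.count n)).sum) +
      (2 ^ (k + 1) + signPart (b + 1) (l.stretchInit k) - signPart b (l.stretchInit k)) *
        l.count n (2 * l.dim + 1) := by
  have h1 : (2 * k + b) / 2 = k := by omega
  have hs : ∀ z, signPart (2 * k + b) z = signPart b z := fun z => by
    rw [signPart, signPart, Nat.mul_add_mod]
  have hs' : ∀ z, signPart (2 * k + b + 1) z = signPart (b + 1) z := fun z => by
    rw [signPart, signPart, add_assoc, Nat.mul_add_mod]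
  have ht : l.recTargets (2 * k + b) = l.recTargets b := by
    simp only [recTargets, add_assoc (2 * k), Nat.mul_add_mod]
  rw [l.count_succ (by omega), row, h1, if_pos hk, hs, hs', ht]
  dsimp only
  rw [List.map_append, List.sum_append, List.map_replicate, List.sum_replicate, smul_eq_mul]
  congr 1
  split_ifs
  · simp [mul_add, add_right_comm]
  · rfl

theorem sum_map_recTargets_count_zero (b : ℕ) : ((l.recTargets b).map (l.count 0)).sum = 0 := by
  have h : ∀ i ∈ Finset.range l.length, ∀ c, l.count 0 (2 * (l.scale * i) + c % 2) = 0 := by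
    intro i hi c
    have : l.scale * i < l.dim := Nat.mul_lt_mul_of_pos_left (Finset.mem_range.1 hi) l.scale_pos
    exact l.count_zero_of_lt (by omega)
  rw [sum_map_recTargets, l.count_zero_of_lt (by omega), mul_zero, add_zero]
  exact Finset.sum_eq_zero fun i hi => by rw [h i hi, h i hi, mul_zero, mul_zero, add_zero]

/-- For longer words, a state with `k + 1 < dim` passes to place `k + 1` with the same sign. The
last place applies the recurrence: its edges to the places `scale * i` yield the correct multiple of
`stretch`, and powers of two with total factor `weight`, which the filler edges complete to `2 ^
dim`. -/
theorem count_succ_eq (n : ℕ) {k b : ℕ} (hk : k < l.dim) (hb : b < 2) :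
    (l.count (n + 1) (2 * k + b) : ℤ) =
      2 ^ (n + k + 1) - (-1) ^ b * stretch l.scale l.seq (n + k) := by
  induction n generalizing k b with
  | zero =>
    have h0 : (if k + 1 < l.dim then l.count 0 (2 * (k + 1) + b)
        else ((l.recTargets b).map (l.count 0)).sum) = 0 := by
      split_ifs
      · exact l.count_zero_of_lt (by omega)
      · exact l.sum_map_recTargets_count_zero b
    -- This makes the natural subtraction in the edge multiplicity exact.
    have hle := l.signPart_stretchInit_le b k
    rw [l.count_row hk hb, h0, count_zero_accept, zero_add, mul_one, zero_add, l.stretch_of_lt hk,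
      ← signPart_sub_signPart_succ, Nat.cast_sub (by omega)]
    push_cast
    ring
  | succ n ih =>
    rw [l.count_row hk hb, count_succ_accept, mul_zero, add_zero]
    split_ifs with hk1
    · rw [ih hk1 hb]
      congr 2 <;> ring_nf
    -- Here `k = dim - 1`.
    · have hD : n + 1 + k = n + l.dim := by omega
      have hc : ∀ i ∈ Finset.range l.length, ∀ c,
          (l.count (n + 1) (2 * (l.scale * i) + c % 2) : ℤ) =
            2 ^ (n + 1) * 2 ^ (l.scale * i) -
              (-1) ^ c * stretch l.scale l.seq (n + l.scale * i) := by
        intro i hi c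
        have : l.scale * i < l.dim :=
          Nat.mul_lt_mul_of_pos_left (Finset.mem_range.1 hi) l.scale_pos
        rw [ih this (Nat.mod_lt c two_pos), ← neg_one_pow_eq_pow_mod_two]
        ring
      have hw : (l.weight : ℤ) = ∑ i ∈ Finset.range l.length,
          ((signPart 0 (l.coeff i) : ℤ) + signPart 1 (l.coeff i)) *
            2 ^ (l.scale * i) := by
        rw [weight, List.sum_map_range_eq_sum, Nat.cast_sum]
        refine Finset.sum_congr rfl fun i _ => ?_
        rw [← signPart_add_signPart_succ 0]
        push_cast
        rfl
      rw [sum_map_recTargets, count_succ_two_mul_dim, hD, stretch_add_dim]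
      push_cast [Nat.cast_sub l.weight_le]
      rw [sub_mul, hw, Finset.sum_mul, Finset.mul_sum]
      have hsum : ∑ i ∈ Finset.range l.length,
          ((signPart 0 (l.coeff i) : ℤ) * l.count (n + 1) (2 * (l.scale * i) + b % 2) +
            signPart 1 (l.coeff i) *
              l.count (n + 1) (2 * (l.scale * i) + (b + 1) % 2)) =
          ∑ i ∈ Finset.range l.length,
            ((signPart 0 (l.coeff i) : ℤ) + signPart 1 (l.coeff i)) *
              2 ^ (l.scale * i) * 2 ^ (n + 1) -
          ∑ i ∈ Finset.range l.length,
            (-1) ^ b * (l.coeff i * stretch l.scale l.seq (n + l.scale * i)) := by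
        rw [← Finset.sum_sub_distrib]
        refine Finset.sum_congr rfl fun i hi => ?_
        have hz := signPart_sub_signPart_succ 0 (l.coeff i)
        rw [zero_add, pow_zero, one_mul] at hz
        rw [hc i hi, hc i hi, pow_succ]
        -- The powers of two from both signs add up, while the stretched terms enter with the
        -- difference of the two parts, which is the coefficient.
        linear_combination (-(-1) ^ b * stretch l.scale l.seq (n + l.scale * i)) * hz
      rw [hsum]
      ring

theorem count_succ_zero (n : ℕ) :
    (l.count (n + 1) 0 : ℤ) = 2 ^ (n + 1) - stretch l.scale l.seq n := by
  -- In dimension `0` the initial state is the filler state `2 * dim`, and the sequence is zero.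
  rcases Nat.eq_zero_or_pos l.dim with h | h
  · have h1 := l.count_succ_two_mul_dim n
    have h2 := l.stretch_add_dim n
    have h3 : l.length = 0 := by
      rcases Nat.mul_eq_zero.1 h with h | h
      · exact absurd h l.scale_pos.ne'
      · exact h
    rw [h, mul_zero] at h1
    rw [h, h3, add_zero, Finset.sum_range_zero] at h2
    rw [h1, h2]
    simp
  · simpa using l.count_succ_eq n h two_pos

theorem ebp_toFinDFA : EBP l.toFinDFA ↔ Positivity l := by
  rw [FinDFA.ebp_iff, Positivity, ← stretch_nonneg_iff l.scale_pos]
  -- Length `n + 1` tests the term `n`, so length `0` carries no information and must satisfy the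
  -- bound by itself.
  have h0 : l.count 0 0 ≤ 2 ^ 0 := by
    rw [l.count_zero (by omega)]
    exact Bool.toNat_le _
  have hn : ∀ n, l.count (n + 1) 0 ≤ 2 ^ (n + 1) ↔ 0 ≤ stretch l.scale l.seq n := by
    intro n
    have := l.count_succ_zero n
    rw [← Nat.cast_le (α := ℤ), this]
    push_cast
    exact sub_le_self_iff _
  exact ⟨fun h n => (hn n).1 (h (n + 1)), fun h n => n.casesOn h0 fun n => (hn n).2 (h n)⟩

end LRS

theorem positivity_manyOneReducible_ebp : Positivity ≤₀ EBP :=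
  ⟨LRS.toFinDFA, LRS.primrec_toFinDFA.to_comp, fun l => l.ebp_toFinDFA.symm⟩

theorem mainTheorem3 :
    ManyOneEquiv EBP Positivity ∧
      ∀ (σ : Type*) [Finite σ] (L : Language σ), L.IsRegular →
        (EqualityTD L ↔ ExponentiallyBounded L) := by
  exact ⟨⟨ebp_manyOneReducible_positivity, positivity_manyOneReducible_ebp⟩,
    fun _ _ _ _ => ⟨EqualityTD.exponentiallyBounded, ExponentiallyBounded.equalityTD⟩⟩
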